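/- Let $d,p\ge 0$ and $m\ge 2$ be integers, let $\mathcal X_B=\{x\in\mathbb R^d:\|x\|_2\le B\}$ and $\mathcal Y=\{0,1\}$, and let $\mathcal D$ be a probability distribution on $\mathcal X_B\times\mathcal Y$. Let $(w,x)\mapsto f_w(x)$, $\mathbb R^p\times\mathbb R^d\to\mathbb R^2$, be a (jointly measurable) family of base predictors with weights $w$; $f_w(x)[c]$ is the score of the class $c\in\mathcal Y$. Let $P$ be a prior probability distribution on the weights $\mathbb R^p$ that does not depend on the training set. A training set $\mathcal S=((x_1,y_1),\dots,(x_m,y_m))$ is drawn from $\mathcal D^m$. The weights $w\in\mathbb R^p$ and the joint law of the random perturbations $(u,v)\in\mathbb R^p\times\mathbb R^d$ may depend on $\mathcal S$; the posterior is the law of $w+u$ (given $\mathcal S$). For $\gamma\ge 0$ the smoothed majority vote classifier $\mathcal G_{\gamma,w}$ returns, at an input $x\in\mathcal X_B$ with label $y$, a class $c\in\mathcal Y$ that maximizes $$\begin{cases}\mathbb P_{u,v}\big(f_{w+u}(x+v)[c]>\max_{j\ne c}f_{w+u}(x+v)[j]+\gamma\big), & c=y,\\ \mathbb P_{u,v}\big(f_{w+u}(x+v)[c]+\gamma>\max_{j\ne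 c}f_{w+u}(x+v)[j]\big), & c\ne y,\end{cases}$$ ties being broken in any way. Put $$\mathcal L_0(\mathcal G)=\mathbb P_{(x,y)\sim\mathcal D}\big(\mathcal G_{0,w}(x)\ne y\big),\qquad \widehat{\mathcal L}_\gamma(\mathcal G)=\frac1m\sum_{i=1}^m\mathbf 1\big[\mathcal G_{\gamma,w}(x_i)\ne y_i\big].$$ Let $\delta,\gamma>0$, and suppose that for every training set $\mathcal S$ $$\mathbb P_{u,v}\Big(\max_{x\in\mathcal X_B}|f_{w+u}(x)-f_w(x)|_\infty<\tfrac{\gamma}{8}\ \text{ and }\ \max_{x\in\mathcal X_B}|f_{w+u}(x+v)-f_w(x)|_\infty<\tfrac{\gamma}{8}\Big)\ge\tfrac12,$$ where $\max_{x\in\mathcal X_B} h(x)<\gamma/8$ means that $h(x)<\gamma/8$ for all $x\in\mathcal X_B$. If this probability is exactly $\tfrac12$, suppose moreover that the maximizing classes that define $\mathcal G_{0,w}$ and $\mathcal G_{\gamma,w}$ are unique (for all $x\in\mathcal X_B$ and $y\in\mathcal Y$). Then, with probability at least $1-\delta$ over the draw of $\mathcal S$, $$\mathcal L_0(\mathcal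 G)\le\widehat{\mathcal L}_\gamma(\mathcal G)+4\sqrt{\frac{\mathrm{KL}(w+u\,\|\,P)+\ln\frac{6m}{\delta}}{m-1}},$$ where the right-hand side is $+\infty$ if the Kullback-Leibler divergence $\mathrm{KL}(w+u\,\|\,P)$ of the posterior from the prior is infinite. -/

import Mathlib

open MeasureTheory InformationTheory
open scoped ENNReal

namespace SmoothedVote

/-- The weight space `ℝᵖ`. -/
abbrev Weights (p : ℕ) := EuclideanSpace ℝ (Fin p)

/-- The ambient input space `ℝᵈ`. The smoothed inputs `x + v` live here. -/
abbrev Ambient (d : ℕ) := EuclideanSpace ℝ (Fin d)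

/-- The input domain `X_B`: the closed Euclidean ball of radius `B` around the origin. -/
abbrev InputDomain (d : ℕ) (B : ℝ) := Metric.closedBall (0 : Ambient d) B

/-- Labelled examples: an input of `X_B` with a label in `{0, 1}`. -/
abbrev Example (d : ℕ) (B : ℝ) := InputDomain d B × Fin 2

/-- A training set of size `m`. -/
abbrev Sample (d : ℕ) (B : ℝ) (m : ℕ) := Fin m → Example d B

/-- A family of base predictors: `f w x c` is the score `f_w(x)[c]` of the class `c`.
The norm of `Fin 2 → ℝ` is the maximum norm. -/
abbrev Predictor (p d : ℕ) := Weights p → Ambient d → (Fin 2 → ℝ)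

/-- The perturbations `(u, v)` that move the scores by less than `γ / 8`, uniformly over
`x ∈ X_B`, both at `x` and at `x + v`. -/
def goodPerturbations {p d : ℕ} (B γ : ℝ) (f : Predictor p d) (w : Weights p) :
    Set (Weights p × Ambient d) :=
  {z | (∀ x ∈ Metric.closedBall (0 : Ambient d) B, ‖f (w + z.1) x - f w x‖ < γ / 8) ∧
       (∀ x ∈ Metric.closedBall (0 : Ambient d) B, ‖f (w + z.1) (x + z.2) - f w x‖ < γ / 8)}

/-- The quantity that the smoothed majority vote with margin `γ` maximizes over the classes `c`,
at the input `x` with label `y`; `ν` is the joint law of the perturbations `(u, v)`.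
There are two classes, so the maximum over the classes `j ≠ c` is the score of `1 - c`. -/
noncomputable def voteScore {p d : ℕ} (f : Predictor p d) (w : Weights p)
    (ν : Measure (Weights p × Ambient d)) (γ : ℝ) (x : Ambient d) (y c : Fin 2) : ℝ :=
  if c = y then
    ν.real {z | f (w + z.1) (x + z.2) c > f (w + z.1) (x + z.2) (1 - c) + γ}
  else
    ν.real {z | f (w + z.1) (x + z.2) c + γ > f (w + z.1) (x + z.2) (1 - c)}

/-- `c` attains the maximum that defines the smoothed majority vote. -/
def IsVote {p d : ℕ} (f : Predictor p d) (w : Weights p)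
    (ν : Measure (Weights p × Ambient d)) (γ : ℝ) (x : Ambient d) (y c : Fin 2) : Prop :=
  ∀ c' : Fin 2, voteScore f w ν γ x y c' ≤ voteScore f w ν γ x y c

/-- `g` is a smoothed majority vote classifier `G_{γ,w}` on `X_B`: at every input `x` (with label
`y`) it returns a maximizing class. Ties may be broken in any way. -/
def IsSmoothedMajorityVote {p d : ℕ} (B : ℝ) (f : Predictor p d) (w : Weights p)
    (ν : Measure (Weights p × Ambient d)) (γ : ℝ) (g : InputDomain d B → Fin 2 → Fin 2) : Prop :=
  ∀ (x : InputDomain d B) (y : Fin 2), IsVote f w ν γ x y (g x y)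

/-- The maximizing class is unique at every input (and for either label). -/
def HasUniqueVotes {p d : ℕ} (B : ℝ) (f : Predictor p d) (w : Weights p)
    (ν : Measure (Weights p × Ambient d)) (γ : ℝ) : Prop :=
  ∀ (x : InputDomain d B) (y : Fin 2), ∃! c : Fin 2, IsVote f w ν γ x y c

/-- The expected loss: the probability, for `(x, y) ∼ D`, that the classifier does not return
`y`. -/
noncomputable def expectedLoss {d : ℕ} {B : ℝ} (D : Measure (Example d B))
    (g : InputDomain d B → Fin 2 → Fin 2) : ℝ :=
  D.real {e | g e.1 e.2 ≠ e.2}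

/-- The empirical loss: the fraction of the training examples `(x, y)` at which the classifier
does not return `y`. -/
noncomputable def empiricalLoss {d : ℕ} {B : ℝ} {m : ℕ} (S : Sample d B m)
    (g : InputDomain d B → Fin 2 → Fin 2) : ℝ :=
  (1 / (m : ℝ)) * ∑ i : Fin m, if g (S i).1 (S i).2 ≠ (S i).2 then (1 : ℝ) else 0

/-- The posterior of the weights: the law of `w + u`, where `(u, v) ∼ ν`. -/
noncomputable def posterior {p d : ℕ} (w : Weights p) (ν : Measure (Weights p × Ambient d)) :
    Measure (Weights p) :=
  ν.map (fun z => w + z.1)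

end SmoothedVote

/-!
On the good perturbations, which have probability at least `1 / 2`, the margin
`f_w(x)[y] - f_w(x)[1 - y]` of the base predictor moves by less than `γ / 4`.
If the margin of `f_w` at `(x, y)` is at least
`γ / 4`, all good perturbations vote for `y` in the vote without margin; if it is less than
`3 γ / 4`, they all vote against `y` in the vote with margin `γ`. Half of the probability decides a
vote between two disjoint events, up to ties, which are excluded by hypothesis
(`SmoothedVote.vote_eq_of_half_le`). Hence the expected loss of the first vote and the empirical
loss of the second compare with the frequencies of margins below `γ / 2` of the *single* predictor
`f_{w + u}`, for each good `u`: its generalization gap is at least the difference of the two losses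
(`SmoothedVote.expectedLoss_sub_empiricalLoss_le_gap`). So the posterior gives probability at least
`1 / 2` to the weights with such a gap. These form a measurable set even though the set of good
perturbations need not be one.

The gap of fixed weights is sub-Gaussian by Hoeffding's inequality. Therefore the average over the
prior of `exp ((m - 1) / 8 * gap²)`, with the positive part of the gap, has expectation at most
`6 m` (`PACBayes.lintegral_lintegral_exp_sq_gap_le`), and it is less than `6 m / δ` outside of an
event of probability at most `δ`. The Donsker-Varadhan inequality changes the measure from the prior
to the posterior (`PACBayes.le_sqrt_klDiv_of_lintegral_exp_lt`): a gap of `t > 0` with posterior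
probability at least `1 / 2` satisfies `(m - 1) / 16 * t² ≤ KL + log (6 m / δ)`.

The exceptional event depends on the prior only. No measurability in the training set of the
weights, the perturbations or the votes is needed.
-/

/-! ### A PAC-Bayesian bound for binary losses -/

namespace PACBayes

open ProbabilityTheory

section Variational

variable {W : Type*} [MeasurableSpace W]

/-- The Donsker-Varadhan inequality. It is the nonnegativity of the divergence of `Q` from the
measure `P.tilted g`. -/
theorem integral_le_klDiv_add_log_integral_exp {Q P : Measure W} [IsProbabilityMeasure Q]
    [IsProbabilityMeasure P] (hQP : klDiv Q P ≠ ∞) {g : W → ℝ} (hg : Integrable g Q)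
    (hexp : Integrable (fun x => Real.exp (g x)) P) :
    ∫ x, g x ∂Q ≤ (klDiv Q P).toReal + Real.log (∫ x, Real.exp (g x) ∂P) := by
  obtain ⟨hac, hllr⟩ := klDiv_ne_top_iff.1 hQP
  have : IsProbabilityMeasure (P.tilted g) := isProbabilityMeasure_tilted hexp
  have hac' : Q ≪ P.tilted g := hac.trans (absolutelyContinuous_tilted hexp)
  have h0 := toReal_klDiv_of_measure_eq hac' (by simp)
  rw [integral_llr_tilted_right hac hg hexp hllr,
    ← toReal_klDiv_of_measure_eq hac (by simp)] at h0
  have : 0 ≤ (klDiv Q (P.tilted g)).toReal := ENNReal.toReal_nonneg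
  linarith

end Variational

section Moment

variable {Ω : Type*} [MeasurableSpace Ω]

/-- A random variable in `[0, 1]` with the Gaussian tail of Hoeffding's inequality has a small
exponential square moment. The proof rounds its values to the grid of the fractions `k / m`. -/
theorem lintegral_exp_sq_le {μ : Measure Ω} [IsProbabilityMeasure μ] {m : ℕ} (hm : 2 ≤ m)
    {X : Ω → ℝ} (hX : Measurable X) (h0 : ∀ ω, 0 ≤ X ω) (h1 : ∀ ω, X ω ≤ 1)
    (htail : ∀ t, 0 ≤ t → μ {ω | t ≤ X ω} ≤ ENNReal.ofReal (Real.exp (-2 * m * t ^ 2))) :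
    ∫⁻ ω, ENNReal.ofReal (Real.exp (((m : ℝ) - 1) / 8 * X ω ^ 2)) ∂μ ≤
      ENNReal.ofReal (6 * m) := by
  have hm0 : (2 : ℝ) ≤ m := by exact_mod_cast hm
  have hmpos : (0 : ℝ) < m := by linarith
  let a : ℕ → ℝ := fun k => Real.exp (((m : ℝ) - 1) / 8 * (((k : ℝ) + 1) / m) ^ 2)
  have hset : ∀ k : ℕ, MeasurableSet {ω | (k : ℝ) / m ≤ X ω} := fun k =>
    measurableSet_le measurable_const hX
  have hpt : ∀ ω, ENNReal.ofReal (Real.exp (((m : ℝ) - 1) / 8 * X ω ^ 2)) ≤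
      ∑ k ∈ Finset.range (m + 1),
        {ω | (k : ℝ) / m ≤ X ω}.indicator (fun _ => ENNReal.ofReal (a k)) ω := by
    intro ω
    have hmX : 0 ≤ m * X ω := mul_nonneg hmpos.le (h0 ω)
    let k := ⌊m * X ω⌋₊
    have hk : (k : ℝ) ≤ m * X ω := Nat.floor_le hmX
    have hk' : m * X ω < k + 1 := Nat.lt_floor_add_one _
    have hkm : k ∈ Finset.range (m + 1) := by
      have : (k : ℝ) ≤ m := hk.trans (by nlinarith [h1 ω])
      have : k ≤ m := by exact_mod_cast this
      simp; omega
    refine le_trans ?_ (Finset.single_le_sum (f := fun k : ℕ =>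
      {ω | (k : ℝ) / m ≤ X ω}.indicator (fun _ => ENNReal.ofReal (a k)) ω)
      (fun _ _ => zero_le) hkm)
    have hmem : ω ∈ {ω | (k : ℝ) / m ≤ X ω} := by
      simp only [Set.mem_ofPred_eq]
      rw [div_le_iff₀ hmpos]; linarith
    simp only [Set.indicator_of_mem hmem]
    refine ENNReal.ofReal_le_ofReal (Real.exp_le_exp.2 ?_)
    have hX' : X ω ≤ ((k : ℝ) + 1) / m := by rw [le_div_iff₀ hmpos]; linarith
    have := h0 ω
    have : 0 ≤ ((m : ℝ) - 1) / 8 := by linarith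
    gcongr
  have hterm : ∀ k : ℕ, a k * Real.exp (-2 * m * ((k : ℝ) / m) ^ 2) ≤ 3 := by
    intro k
    rw [← Real.exp_add]
    refine le_trans (Real.exp_le_exp.2 (?_ : _ ≤ (1 : ℝ)))
      (Real.exp_one_lt_d9.le.trans (by norm_num))
    have e : ((m : ℝ) - 1) / 8 * (((k : ℝ) + 1) / m) ^ 2 + -2 * m * ((k : ℝ) / m) ^ 2
        = (((m : ℝ) - 1) / 8 * ((k : ℝ) + 1) ^ 2 - 2 * m * (k : ℝ) ^ 2) / m ^ 2 := by
      field_simp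
      ring
    rw [e, div_le_one (by positivity)]
    have hk0 : (0 : ℝ) ≤ k := k.cast_nonneg
    -- `(k + 1)² ≤ 2 k² + 2`, so the terms with `k²` have a negative coefficient
    nlinarith [mul_nonneg (by linarith : (0 : ℝ) ≤ (m : ℝ) - 1) (sq_nonneg ((k : ℝ) - 1)),
      mul_nonneg hmpos.le (sq_nonneg (k : ℝ)), sq_nonneg (k : ℝ)]
  calc ∫⁻ ω, ENNReal.ofReal (Real.exp (((m : ℝ) - 1) / 8 * X ω ^ 2)) ∂μ
      ≤ ∫⁻ ω, ∑ k ∈ Finset.range (m + 1),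
          {ω | (k : ℝ) / m ≤ X ω}.indicator (fun _ => ENNReal.ofReal (a k)) ω ∂μ :=
        lintegral_mono hpt
    _ = ∑ k ∈ Finset.range (m + 1), ENNReal.ofReal (a k) * μ {ω | (k : ℝ) / m ≤ X ω} := by
        rw [lintegral_finsetSum _ fun k _ => measurable_const.indicator (hset k)]
        exact Finset.sum_congr rfl fun k _ => lintegral_indicator_const (hset k) _
    _ ≤ ∑ k ∈ Finset.range (m + 1), ENNReal.ofReal 3 := by
        refine Finset.sum_le_sum fun k _ => ?_
        refine (mul_le_mul_right (htail _ (by positivity)) _).trans ?_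
        rw [← ENNReal.ofReal_mul (Real.exp_pos _).le]
        exact ENNReal.ofReal_le_ofReal (hterm k)
    _ = ENNReal.ofReal (3 * (m + 1)) := by
        rw [Finset.sum_const, Finset.card_range, ← ENNReal.ofReal_nsmul]
        congr 1; simp; ring
    _ ≤ ENNReal.ofReal (6 * m) := ENNReal.ofReal_le_ofReal (by linarith)

end Moment

variable {W Z : Type*} [MeasurableSpace W] [MeasurableSpace Z] {m : ℕ}

/-- The generalization gap of the parameter `w` on the sample `S`: the probability of an error
minus the frequency of errors, where `A` is the set of the pairs `(w, z)` such that `w` errs at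
the example `z`. -/
noncomputable def gap (D : Measure Z) (A : Set (W × Z)) (S : Fin m → Z) (w : W) : ℝ :=
  D.real (Prod.mk w ⁻¹' A) - (1 / (m : ℝ)) * ∑ i, A.indicator (fun _ => (1 : ℝ)) (w, S i)

theorem measurable_gap (D : Measure Z) [IsProbabilityMeasure D] {A : Set (W × Z)}
    (hA : MeasurableSet A) :
    Measurable (fun q : (Fin m → Z) × W => gap D A q.1 q.2) := by
  unfold gap
  refine Measurable.sub ?_ (Measurable.const_mul (Finset.measurable_fun_sum _ fun i _ => ?_) _)
  · exact ((measurable_measure_prodMk_left hA).ennreal_toReal).comp measurable_snd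
  · exact (measurable_const.indicator hA).comp (measurable_snd.prodMk
      ((measurable_pi_apply i).comp measurable_fst))

theorem gap_le_one {V : Type*} (D : Measure Z) [IsProbabilityMeasure D] (A : Set (V × Z))
    (S : Fin m → Z) (w : V) : gap D A S w ≤ 1 := by
  have h1 : D.real (Prod.mk w ⁻¹' A) ≤ 1 := measureReal_le_one
  have h2 : 0 ≤ (1 / (m : ℝ)) * ∑ i, A.indicator (fun _ => (1 : ℝ)) (w, S i) :=
    mul_nonneg (by positivity)
      (Finset.sum_nonneg fun i _ => Set.indicator_nonneg (fun _ _ => zero_le_one) _)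
  unfold gap
  linarith

/-- Hoeffding's inequality for the gap of a fixed parameter. -/
theorem measure_le_gap (D : Measure Z) [IsProbabilityMeasure D] {A : Set (W × Z)}
    (hA : MeasurableSet A) (hm : 0 < m) (w : W) {t : ℝ} (ht : 0 ≤ t) :
    (Measure.pi fun _ : Fin m => D) {S | t ≤ gap D A S w} ≤
      ENNReal.ofReal (Real.exp (-2 * m * t ^ 2)) := by
  have hmpos : (0 : ℝ) < m := by exact_mod_cast hm
  have hAw : MeasurableSet (Prod.mk w ⁻¹' A) := measurable_prodMk_left hA
  let Y : Z → ℝ := fun z => -(A.indicator (fun _ => (1 : ℝ)) (w, z))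
  have hYm : Measurable Y := ((measurable_const.indicator hA).comp measurable_prodMk_left).neg
  have hYint : ∫ z, Y z ∂D = -D.real (Prod.mk w ⁻¹' A) := by
    rw [integral_neg]
    congr 1
    exact integral_indicator_one hAw
  have hindep : iIndepFun (fun (i : Fin m) (S : Fin m → Z) => Y (S i) - ∫ z, Y z ∂D)
      (Measure.pi fun _ : Fin m => D) :=
    iIndepFun_pi (X := fun (_ : Fin m) z => Y z - ∫ z, Y z ∂D)
      fun _ => (hYm.sub_const _).aemeasurable
  have hsub : ∀ i ∈ (Finset.univ : Finset (Fin m)),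
      HasSubgaussianMGF (fun S : Fin m → Z => Y (S i) - ∫ z, Y z ∂D)
        ((‖(0 : ℝ) - (-1)‖₊ / 2) ^ 2) (Measure.pi fun _ : Fin m => D) := by
    intro i _
    have h := hasSubgaussianMGF_of_mem_Icc (μ := Measure.pi fun _ : Fin m => D)
      (X := fun S => Y (S i)) (a := -1) (b := 0)
      (hYm.comp (measurable_pi_apply i)).aemeasurable
      (Filter.Eventually.of_forall fun S => by
        by_cases hz : (w, S i) ∈ A <;> simp [Y, hz])
    have e : ∫ S : Fin m → Z, Y (S i) ∂(Measure.pi fun _ : Fin m => D) = ∫ z, Y z ∂D :=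
      integral_comp_eval (μ := fun _ : Fin m => D) (i := i) hYm.aestronglyMeasurable
    rwa [e] at h
  have h := HasSubgaussianMGF.measure_sum_ge_le_of_iIndepFun hindep hsub
    (ε := m * t) (by positivity)
  have hset : {S : Fin m → Z | t ≤ gap D A S w} =
      {S | m * t ≤ ∑ i, (Y (S i) - ∫ z, Y z ∂D)} := by
    ext S
    have e : ∑ i, (Y (S i) - ∫ z, Y z ∂D) = m * gap D A S w := by
      rw [hYint, Finset.sum_sub_distrib, Finset.sum_const, Finset.card_univ, Fintype.card_fin,
        nsmul_eq_mul, Finset.sum_neg_distrib, gap]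
      field_simp
      ring
    simp only [Set.mem_ofPred_eq]
    rw [e, mul_le_mul_iff_right₀ hmpos]
  rw [hset, ← ofReal_measureReal]
  refine ENNReal.ofReal_le_ofReal (h.trans (Real.exp_le_exp.2 (le_of_eq ?_)))
  simp
  field_simp

/-- The exponential square moment of the positive part of the gap, averaged over a prior that does
not depend on the sample, is at most `6 m`. -/
theorem lintegral_lintegral_exp_sq_gap_le (D : Measure Z) [IsProbabilityMeasure D]
    {A : Set (W × Z)} (hA : MeasurableSet A) (P : Measure W) [IsProbabilityMeasure P]
    (hm : 2 ≤ m) :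
    ∫⁻ S, ∫⁻ w, ENNReal.ofReal (Real.exp (((m : ℝ) - 1) / 8 * (max (gap D A S w) 0) ^ 2)) ∂P
      ∂(Measure.pi fun _ : Fin m => D) ≤ ENNReal.ofReal (6 * m) := by
  have hmeas := (measurable_gap (m := m) D hA).max (measurable_const (a := (0 : ℝ)))
  rw [lintegral_lintegral_swap]
  · calc _ ≤ ∫⁻ _ : W, ENNReal.ofReal (6 * m) ∂P := by
          refine lintegral_mono fun w => lintegral_exp_sq_le hm
            (hmeas.comp measurable_prodMk_right) (fun S => le_max_right _ _)
            (fun S => max_le (gap_le_one D A S w) zero_le_one) fun t ht => ?_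
          rcases ht.eq_or_lt with rfl | ht
          · simp
          · have : {S : Fin m → Z | t ≤ max (gap D A S w) 0} = {S | t ≤ gap D A S w} := by
              ext S; simp [ht.not_ge]
            rw [this]
            exact measure_le_gap D hA (by omega) w ht.le
      _ = ENNReal.ofReal (6 * m) := by simp
  · exact (Real.measurable_exp.comp ((hmeas.pow_const 2).const_mul _)).ennreal_ofReal.aemeasurable

/-- A bound on the exponential square moment under the prior bounds the gaps that a posterior
attains with probability at least `1 / 2`. -/
theorem le_sqrt_klDiv_of_lintegral_exp_lt {D : Measure Z} [IsProbabilityMeasure D]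
    {A : Set (W × Z)} (hA : MeasurableSet A) {P Q : Measure W} [IsProbabilityMeasure P]
    [IsProbabilityMeasure Q] (hm : 2 ≤ m) {S : Fin m → Z} {K : ℝ}
    (hK : ∫⁻ w, ENNReal.ofReal (Real.exp (((m : ℝ) - 1) / 8 * (max (gap D A S w) 0) ^ 2)) ∂P <
      ENNReal.ofReal K)
    (hQP : klDiv Q P ≠ ∞) {t : ℝ} (hQ : 1 / 2 ≤ Q {w | t ≤ gap D A S w}) :
    t ≤ 4 * Real.sqrt (((klDiv Q P).toReal + Real.log K) / ((m : ℝ) - 1)) := by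
  rcases le_or_gt t 0 with ht | ht
  · exact ht.trans (by positivity)
  have hm0 : (2 : ℝ) ≤ m := by exact_mod_cast hm
  have hmeas : Measurable fun w => max (gap D A S w) 0 :=
    ((measurable_gap (m := m) D hA).comp measurable_prodMk_left).max measurable_const
  let g : W → ℝ := fun w => ((m : ℝ) - 1) / 8 * (max (gap D A S w) 0) ^ 2
  have hgm : Measurable g := (hmeas.pow_const 2).const_mul _
  have hg0 : ∀ w, 0 ≤ g w := fun w => mul_nonneg (by linarith) (sq_nonneg _)
  have hgle : ∀ w, g w ≤ ((m : ℝ) - 1) / 8 := fun w => by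
    have h1 : max (gap D A S w) 0 ≤ 1 := max_le (gap_le_one D A S w) zero_le_one
    have h2 : (max (gap D A S w) 0) ^ 2 ≤ 1 := pow_le_one₀ (le_max_right _ _) h1
    exact mul_le_of_le_one_right (by linarith) h2
  have hgQ : Integrable g Q := Integrable.of_bound hgm.aestronglyMeasurable (((m : ℝ) - 1) / 8)
    (Filter.Eventually.of_forall fun w => by
      rw [Real.norm_of_nonneg (hg0 w)]; exact hgle w)
  have hgP : Integrable (fun w => Real.exp (g w)) P :=
    Integrable.of_bound (Real.measurable_exp.comp hgm).aestronglyMeasurable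
      (Real.exp (((m : ℝ) - 1) / 8)) (Filter.Eventually.of_forall fun w => by
        rw [Real.norm_of_nonneg (Real.exp_pos _).le]; exact Real.exp_le_exp.2 (hgle w))
  have hlog : Real.log (∫ w, Real.exp (g w) ∂P) ≤ Real.log K := by
    refine Real.log_le_log (integral_exp_pos hgP) ?_
    rw [← ofReal_integral_eq_lintegral_ofReal hgP
      (Filter.Eventually.of_forall fun w => (Real.exp_pos _).le)] at hK
    exact (ENNReal.ofReal_lt_ofReal_iff'.1 hK).1.le
  have hlow : ((m : ℝ) - 1) / 8 * t ^ 2 * (1 / 2) ≤ ∫ w, g w ∂Q := by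
    have hQ' : 1 / 2 ≤ Q.real {w | t ≤ gap D A S w} := by
      have := ENNReal.toReal_mono (measure_ne_top Q _) hQ
      simpa [measureReal_def] using this
    have hsub : Q.real {w | t ≤ gap D A S w} ≤
        Q.real {w | ((m : ℝ) - 1) / 8 * t ^ 2 ≤ g w} := by
      refine measureReal_mono fun w hw => ?_
      simp only [Set.mem_ofPred_eq] at hw ⊢
      have h1 : t ≤ max (gap D A S w) 0 := hw.trans (le_max_left _ _)
      have h2 : 0 ≤ ((m : ℝ) - 1) / 8 := by linarith
      simp only [g]
      gcongr
    refine le_trans ?_ (mul_meas_ge_le_integral_of_nonneg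
      (Filter.Eventually.of_forall hg0) hgQ (((m : ℝ) - 1) / 8 * t ^ 2))
    exact mul_le_mul_of_nonneg_left (hQ'.trans hsub)
      (mul_nonneg (by linarith) (sq_nonneg _))
  have hDV := integral_le_klDiv_add_log_integral_exp hQP hgQ hgP
  have hsq : (t / 4) ^ 2 ≤ ((klDiv Q P).toReal + Real.log K) / ((m : ℝ) - 1) := by
    rw [le_div_iff₀ (by linarith)]
    linarith
  have := Real.le_sqrt_of_sq_le hsq
  linarith

/-- The exceptional event of the PAC-Bayesian bound, by Markov's inequality. Only the prior enters
its definition, so outside of it `le_sqrt_klDiv_of_lintegral_exp_lt` applies to posteriors that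
depend on the sample in any way, measurable or not. -/
theorem measure_lintegral_exp_ge_le (D : Measure Z) [IsProbabilityMeasure D]
    {A : Set (W × Z)} (hA : MeasurableSet A) (P : Measure W) [IsProbabilityMeasure P]
    (hm : 2 ≤ m) {δ : ℝ} (hδ : 0 < δ) :
    (Measure.pi fun _ : Fin m => D) {S | ENNReal.ofReal (6 * m / δ) ≤
      ∫⁻ w, ENNReal.ofReal (Real.exp (((m : ℝ) - 1) / 8 * (max (gap D A S w) 0) ^ 2)) ∂P} ≤
      ENNReal.ofReal δ := by
  have hmpos : (0 : ℝ) < m := by exact_mod_cast (by omega : 0 < m)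
  have hmeas := (measurable_gap (m := m) D hA).max (measurable_const (a := (0 : ℝ)))
  have hF : Measurable fun S : Fin m → Z => ∫⁻ w, ENNReal.ofReal
      (Real.exp (((m : ℝ) - 1) / 8 * (max (gap D A S w) 0) ^ 2)) ∂P :=
    Measurable.lintegral_prod_right'
      (Real.measurable_exp.comp ((hmeas.pow_const 2).const_mul _)).ennreal_ofReal
  refine (meas_ge_le_lintegral_div hF.aemeasurable
    (by simp only [ne_eq, ENNReal.ofReal_eq_zero, not_le]; positivity)
    ENNReal.ofReal_ne_top).trans ?_
  refine (ENNReal.div_le_div_right (lintegral_lintegral_exp_sq_gap_le D hA P hm) _).trans ?_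
  rw [← ENNReal.ofReal_div_of_pos (by positivity)]
  refine ENNReal.ofReal_le_ofReal (le_of_eq ?_)
  field_simp

end PACBayes

/-! ### Margins and the smoothed majority vote -/

namespace SmoothedVote

variable {p d : ℕ}

/-- The margin of the base predictor with weights `w` at the input `x` with label `y`: the score
of `y` minus the score of the other class. -/
def margin (f : Predictor p d) (w : Weights p) (x : Ambient d) (y : Fin 2) : ℝ :=
  f w x y - f w x (1 - y)

/-- The pairs of weights and a labelled example at which the margin is less than `θ`. -/
def marginErrors (B : ℝ) (f : Predictor p d) (θ : ℝ) : Set (Weights p × Example d B) :=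
  {q | margin f q.1 q.2.1 q.2.2 < θ}

theorem measurable_score {f : Predictor p d} (hf : Measurable (Function.uncurry f)) (c : Fin 2) :
    Measurable fun q : Weights p × Ambient d => f q.1 q.2 c :=
  (measurable_pi_apply c).comp hf

theorem measurable_margin {f : Predictor p d} (hf : Measurable (Function.uncurry f)) (y : Fin 2) :
    Measurable fun q : Weights p × Ambient d => margin f q.1 q.2 y :=
  (measurable_score hf y).sub (measurable_score hf (1 - y))

theorem measurableSet_marginErrors (B : ℝ) {f : Predictor p d}
    (hf : Measurable (Function.uncurry f)) (θ : ℝ) :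
    MeasurableSet (marginErrors B f θ) := by
  have h : marginErrors B f θ = ⋃ c : Fin 2, {q | q.2.2 = c} ∩
      {q | margin f q.1 q.2.1 c < θ} := by
    ext q
    simp [marginErrors]
  rw [h]
  refine MeasurableSet.iUnion fun c => MeasurableSet.inter ?_ ?_
  · exact measurableSet_eq_fun (measurable_snd.comp measurable_snd) measurable_const
  · exact measurableSet_lt ((measurable_margin hf c).comp (measurable_fst.prodMk
      (measurable_subtype_coe.comp (measurable_fst.comp measurable_snd)))) measurable_const

/-- Scores that are less than `ε` apart in the maximum norm have margins less than `2 ε` apart. -/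
theorem abs_margin_sub_margin_lt {f : Predictor p d} {w w' : Weights p} {x x' : Ambient d} {ε : ℝ}
    (h : ‖f w' x' - f w x‖ < ε) (y : Fin 2) :
    |margin f w' x' y - margin f w x y| < 2 * ε := by
  have h1 := (norm_le_pi_norm (f w' x' - f w x) y).trans_lt h
  have h2 := (norm_le_pi_norm (f w' x' - f w x) (1 - y)).trans_lt h
  simp only [Pi.sub_apply, Real.norm_eq_abs, abs_lt] at h1 h2
  unfold margin
  rw [abs_lt]
  constructor <;> linarith

variable {f : Predictor p d} {w : Weights p} {ν : Measure (Weights p × Ambient d)} {γ : ℝ}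
  {x : Ambient d} {y : Fin 2}

theorem voteScore_label :
    voteScore f w ν γ x y y = ν.real {z | γ < margin f (w + z.1) (x + z.2) y} := by
  simp only [voteScore, if_true, margin, gt_iff_lt, lt_sub_iff_add_lt']

theorem voteScore_of_ne {c : Fin 2} (hc : c ≠ y) :
    voteScore f w ν γ x y c = ν.real {z | margin f (w + z.1) (x + z.2) y < γ} := by
  have h : c = 1 - y := by revert c y; decide
  have h' : 1 - c = y := by revert c y; decide
  simp only [voteScore, if_neg hc, h', margin, gt_iff_lt, sub_lt_iff_lt_add', ← h, add_comm]

/-- The scores of the two classes belong to disjoint events, so they add up to at most `1`. -/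
theorem voteScore_add_le_one [IsProbabilityMeasure ν] (hf : Measurable (Function.uncurry f))
    {c : Fin 2} (hc : c ≠ y) :
    voteScore f w ν γ x y y + voteScore f w ν γ x y c ≤ 1 := by
  have hm : Measurable fun z : Weights p × Ambient d => margin f (w + z.1) (x + z.2) y :=
    (measurable_margin hf y).comp
      ((measurable_fst.const_add w).prodMk (measurable_snd.const_add x))
  rw [voteScore_label, voteScore_of_ne hc, ← measureReal_union _
    (measurableSet_lt hm measurable_const)]
  · exact measureReal_le_one
  · exact Set.disjoint_left.2 fun z h1 h2 => lt_asymm (Set.mem_ofPred_eq ▸ h1) h2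

/-- A class whose event contains a set of probability at least `1 / 2` wins the vote, provided that
the vote has a unique winner if that probability is exactly `1 / 2`. The set need not be
measurable. -/
theorem vote_eq_of_half_le [IsProbabilityMeasure ν] (hf : Measurable (Function.uncurry f))
    {s : Set (Weights p × Ambient d)} (hs : 1 / 2 ≤ ν s)
    (huniq : ν s = 1 / 2 → ∃! c : Fin 2, IsVote f w ν γ x y c) {a b : Fin 2}
    (ha : ν.real s ≤ voteScore f w ν γ x y a) (hb : IsVote f w ν γ x y b) : b = a := by
  by_contra hne
  have hs' : 1 / 2 ≤ ν.real s := by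
    have := ENNReal.toReal_mono (measure_ne_top ν _) hs
    simpa [measureReal_def] using this
  have hsum : voteScore f w ν γ x y a + voteScore f w ν γ x y b ≤ 1 := by
    rcases eq_or_ne a y with rfl | hay
    · exact voteScore_add_le_one hf hne
    · have hby : b = y := by omega
      subst hby
      rw [add_comm]
      exact voteScore_add_le_one hf hay
  have hab := hb a
  -- All inequalities are equalities, so that there is a tie, which uniqueness excludes.
  have hhalf : ν s = 1 / 2 := by
    have : ν.real s = 1 / 2 := by linarith
    rw [← ofReal_measureReal (μ := ν) (s := s), this, ENNReal.ofReal_div_of_pos two_pos]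
    simp
  have hva : IsVote f w ν γ x y a := fun c => (hb c).trans (by linarith)
  exact hne ((huniq hhalf).unique hb hva)

section Smoothed

variable {B : ℝ} {g : InputDomain d B → Fin 2 → Fin 2}

/-- If the vote without margin errs, then the margin of the base predictor is less than `γ / 4`. -/
theorem margin_lt_of_smoothedVote_zero_ne [IsProbabilityMeasure ν]
    (hf : Measurable (Function.uncurry f))
    (hgood : 1 / 2 ≤ ν (goodPerturbations B γ f w))
    (hties : ν (goodPerturbations B γ f w) = 1 / 2 → HasUniqueVotes B f w ν 0)
    (hg : IsSmoothedMajorityVote B f w ν 0 g) {x : InputDomain d B} {y : Fin 2}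
    (hxy : g x y ≠ y) : margin f w x y < γ / 4 := by
  by_contra! hM
  refine hxy (vote_eq_of_half_le hf hgood (fun h => hties h x y) ?_ (hg x y))
  rw [voteScore_label]
  refine measureReal_mono fun z hz => ?_
  have := abs_lt.1 (abs_margin_sub_margin_lt (hz.2 x x.2) y)
  simp only [Set.mem_ofPred_eq]
  linarith

/-- If the margin of the base predictor is less than `3 γ / 4`, then the vote with margin `γ`
errs. -/
theorem smoothedVote_ne_of_margin_lt [IsProbabilityMeasure ν]
    (hf : Measurable (Function.uncurry f))
    (hgood : 1 / 2 ≤ ν (goodPerturbations B γ f w))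
    (hties : ν (goodPerturbations B γ f w) = 1 / 2 → HasUniqueVotes B f w ν γ)
    (hg : IsSmoothedMajorityVote B f w ν γ g) {x : InputDomain d B} {y : Fin 2}
    (hM : margin f w x y < 3 * γ / 4) : g x y ≠ y := by
  have hne : 1 - y ≠ y := (by decide : ∀ c : Fin 2, 1 - c ≠ c) y
  rw [vote_eq_of_half_le hf hgood (fun h => hties h x y) (a := 1 - y) ?_ (hg x y)]
  · exact hne
  rw [voteScore_of_ne hne]
  refine measureReal_mono fun z hz => ?_
  have := abs_lt.1 (abs_margin_sub_margin_lt (hz.2 x x.2) y)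
  simp only [Set.mem_ofPred_eq]
  linarith

/-- The difference of the losses of the two votes is at most the generalization gap, for the
threshold `γ / 2` on the margin, of any single perturbed base predictor `w + u` with a good
perturbation: its margins are less than `γ / 4` away from those of `w`. -/
theorem expectedLoss_sub_empiricalLoss_le_gap {m : ℕ} [IsProbabilityMeasure ν]
    (D : Measure (Example d B)) [IsProbabilityMeasure D]
    (hf : Measurable (Function.uncurry f))
    (hgood : 1 / 2 ≤ ν (goodPerturbations B γ f w))
    (hties : ν (goodPerturbations B γ f w) = 1 / 2 →
      HasUniqueVotes B f w ν 0 ∧ HasUniqueVotes B f w ν γ)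
    {g₀ gγ : InputDomain d B → Fin 2 → Fin 2}
    (hg₀ : IsSmoothedMajorityVote B f w ν 0 g₀) (hgγ : IsSmoothedMajorityVote B f w ν γ gγ)
    (S : Sample d B m) {z : Weights p × Ambient d} (hz : z ∈ goodPerturbations B γ f w) :
    expectedLoss D g₀ - empiricalLoss S gγ ≤
      PACBayes.gap D (marginErrors B f (γ / 2)) S (w + z.1) := by
  have hclose : ∀ (x : InputDomain d B) (y : Fin 2),
      |margin f (w + z.1) x y - margin f w x y| < 2 * (γ / 8) :=
    fun x y => abs_margin_sub_margin_lt (hz.1 x x.2) y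
  unfold PACBayes.gap
  refine sub_le_sub ?_ ?_
  · refine measureReal_mono fun e he => ?_
    have h1 := margin_lt_of_smoothedVote_zero_ne hf hgood (fun h => (hties h).1) hg₀ he
    have h2 := abs_lt.1 (hclose e.1 e.2)
    simp only [marginErrors, Set.mem_preimage, Set.mem_ofPred_eq]
    linarith
  · refine mul_le_mul_of_nonneg_left (Finset.sum_le_sum fun i _ => ?_) (by positivity)
    refine Set.indicator_apply_le' (fun hi => ?_) fun _ => by split_ifs <;> norm_num
    have h2 := abs_lt.1 (hclose (S i).1 (S i).2)
    simp only [marginErrors, Set.mem_ofPred_eq] at hi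
    rw [if_pos (smoothedVote_ne_of_margin_lt hf hgood (fun h => (hties h).2) hgγ (by linarith))]

instance isProbabilityMeasure_posterior [IsProbabilityMeasure ν] :
    IsProbabilityMeasure (posterior w ν) :=
  Measure.isProbabilityMeasure_map (measurable_fst.const_add w).aemeasurable

/-- With probability at least `1 / 2`, weights drawn from the posterior have a generalization gap
at least as large as the difference of the losses of the two votes. -/
theorem half_le_posterior_gap {m : ℕ} [IsProbabilityMeasure ν]
    (D : Measure (Example d B)) [IsProbabilityMeasure D]
    (hf : Measurable (Function.uncurry f))
    (hgood : 1 / 2 ≤ ν (goodPerturbations B γ f w))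
    (hties : ν (goodPerturbations B γ f w) = 1 / 2 →
      HasUniqueVotes B f w ν 0 ∧ HasUniqueVotes B f w ν γ)
    {g₀ gγ : InputDomain d B → Fin 2 → Fin 2}
    (hg₀ : IsSmoothedMajorityVote B f w ν 0 g₀) (hgγ : IsSmoothedMajorityVote B f w ν γ gγ)
    (S : Sample d B m) :
    1 / 2 ≤ posterior w ν {w' | expectedLoss D g₀ - empiricalLoss S gγ ≤
      PACBayes.gap D (marginErrors B f (γ / 2)) S w'} := by
  refine (hgood.trans (measure_mono fun z hz => ?_)).trans
    (Measure.le_map_apply (measurable_fst.const_add w).aemeasurable _)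
  exact expectedLoss_sub_empiricalLoss_le_gap D hf hgood hties hg₀ hgγ S hz

end Smoothed

end SmoothedVote

/-- The trained weights `w S` and the joint law `ν S` of the perturbations `(u, v)` may depend on
the training set `S` in any way; the prior `P` does not depend on it. The bound is void where the
Kullback-Leibler divergence is infinite. `G₀ S` and `Gγ S` are the smoothed majority vote
classifiers with margins `0` and `γ`. -/
theorem lemma3p1 (p d m : ℕ) (hm : 2 ≤ m) (B : ℝ)
    (f : SmoothedVote.Predictor p d) (hf : Measurable (Function.uncurry f))
    (D : Measure (SmoothedVote.Example d B)) [IsProbabilityMeasure D]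
    (P : Measure (SmoothedVote.Weights p)) [IsProbabilityMeasure P]
    (δ γ : ℝ) (hδ : 0 < δ) (hγ : 0 < γ)
    (w : SmoothedVote.Sample d B m → SmoothedVote.Weights p)
    (ν : SmoothedVote.Sample d B m →
      Measure (SmoothedVote.Weights p × SmoothedVote.Ambient d))
    (hν : ∀ S, IsProbabilityMeasure (ν S))
    (hgood : ∀ S, 1 / 2 ≤ ν S (SmoothedVote.goodPerturbations B γ f (w S)))
    (hties : ∀ S, ν S (SmoothedVote.goodPerturbations B γ f (w S)) = 1 / 2 →
      SmoothedVote.HasUniqueVotes B f (w S) (ν S) 0 ∧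
      SmoothedVote.HasUniqueVotes B f (w S) (ν S) γ)
    (G₀ Gγ : SmoothedVote.Sample d B m → SmoothedVote.InputDomain d B → Fin 2 → Fin 2)
    (hG₀ : ∀ S, SmoothedVote.IsSmoothedMajorityVote B f (w S) (ν S) 0 (G₀ S))
    (hGγ : ∀ S, SmoothedVote.IsSmoothedMajorityVote B f (w S) (ν S) γ (Gγ S)) :
    Measure.pi (fun _ : Fin m => D)
      {S | ¬ (klDiv (SmoothedVote.posterior (w S) (ν S)) P ≠ ∞ →
        SmoothedVote.expectedLoss D (G₀ S) ≤
          SmoothedVote.empiricalLoss S (Gγ S) +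
            4 * Real.sqrt
              (((klDiv (SmoothedVote.posterior (w S) (ν S)) P).toReal +
                Real.log (6 * m / δ)) / ((m : ℝ) - 1)))} ≤ ENNReal.ofReal δ := by
  have hA := SmoothedVote.measurableSet_marginErrors B hf (γ / 2)
  refine le_trans (measure_mono fun S hS => ?_)
    (PACBayes.measure_lintegral_exp_ge_le D hA P hm hδ)
  simp only [Set.mem_ofPred_eq] at hS ⊢
  contrapose! hS
  intro hKL
  have := hν S
  rw [← sub_le_iff_le_add']
  exact PACBayes.le_sqrt_klDiv_of_lintegral_exp_lt hA hm hS hKL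
    (SmoothedVote.half_le_posterior_gap D hf (hgood S) (hties S) (hG₀ S) (hGγ S) S)
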